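/- Let $\mathcal F^2(\mathbb C)$ be the Fock space of entire functions that are square integrable with respect to the Gaussian measure $\frac1\pi e^{-|z|^2}\,dV(z)$ on $\mathbb C$, with the inner product $\langle f,g\rangle=\frac1\pi\int_{\mathbb C}f(z)\overline{g(z)}e^{-|z|^2}\,dV(z)$. For complex numbers $a,b,c$ with $|a|=1$, $\bar a b+\bar b=0$ and $|c|^2e^{|b|^2}=1$, let $\mathcal C_{a,b,c}$ be the weighted composition conjugation on $\mathcal F^2(\mathbb C)$, $$\mathcal C_{a,b,c}f(z)=c\,e^{bz}\,\overline{f\left(\overline{az+b}\right)}.$$ On $L^2(\mathbb R)$ let $\mathcal Tf(x)=\overline{f(x)}$ and $\mathcal{PT}f(x)=\overline{f(-x)}$. Let $U$ be the Segal–Bargmann transform $$Uf(z)=\int_{\mathbb R}A(z,x)f(x)\,dx,\qquad A(z,x)=\pi^{-1/4}e^{(-z^2+2\sqrt2\,xz-x^2)/2},\qquad f\in L^2(\mathbb R),\ z\in\mathbb C.$$ Then $U$ is a unitary operator from $L^2(\mathbb R)$ onto $\mathcal F^2(\mathbb C)$, and the following identities hold on $\mathcal F^2(\mathbb C)$: $$U\,\mathcal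 T\,U^{-1}=\mathcal C_{1,0,1},\qquad U\,\mathcal{PT}\,U^{-1}=\mathcal C_{-1,0,1}.$$ -/

import Mathlib

open MeasureTheory
open scoped ComplexConjugate ENNReal

noncomputable section

/-! ### Fock space -/

/-- The Gaussian measure `π⁻¹ e^{-|z|²} dV(z)` on the complex plane, `dV` the Lebesgue measure. -/
def fockMeasure : Measure ℂ :=
  volume.withDensity fun z => ENNReal.ofReal (Real.pi⁻¹ * Real.exp (-‖z‖ ^ 2))

/-- The vector space of entire functions that are square integrable for the Gaussian measure. -/
def fockSubmodule : Submodule ℂ (ℂ → ℂ) where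
  carrier := {f | Differentiable ℂ f ∧ MemLp f 2 fockMeasure}
  add_mem' hf hg := ⟨hf.1.add hg.1, hf.2.add hg.2⟩
  zero_mem' := ⟨differentiable_const 0, MemLp.zero⟩
  smul_mem' c _ hf := ⟨hf.1.const_smul c, hf.2.const_smul c⟩

/-- The Fock space `ℱ²(ℂ)`. It is a separate type, so that its topology is the one of its inner
product and not that of pointwise convergence. -/
def FockSpace : Type := fockSubmodule

namespace FockSpace

instance : AddCommGroup FockSpace := inferInstanceAs (AddCommGroup fockSubmodule)

instance : Module ℂ FockSpace := inferInstanceAs (Module ℂ fockSubmodule)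

instance : FunLike FockSpace ℂ ℂ where
  coe f := f.1
  coe_injective _ _ h := Subtype.ext h

/-- An element of Fock space from an entire, square integrable function. -/
def mk (f : ℂ → ℂ) (hd : Differentiable ℂ f) (hf : MemLp f 2 fockMeasure) : FockSpace :=
  ⟨f, hd, hf⟩

@[simp] theorem mk_apply (f : ℂ → ℂ) (hd : Differentiable ℂ f) (hf : MemLp f 2 fockMeasure)
    (z : ℂ) : mk f hd hf z = f z := rfl

@[simp] theorem add_apply (f g : FockSpace) (z : ℂ) : (f + g) z = f z + g z := rfl

@[simp] theorem smul_apply (c : ℂ) (f : FockSpace) (z : ℂ) : (c • f) z = c * f z := rfl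

@[simp] theorem zero_apply (z : ℂ) : (0 : FockSpace) z = 0 := rfl

theorem differentiable (f : FockSpace) : Differentiable ℂ f := f.2.1

theorem memLp (f : FockSpace) : MemLp f 2 fockMeasure := f.2.2

theorem integrable_conj_mul (f g : FockSpace) :
    Integrable (fun z => conj (f z) * g z) fockMeasure :=
  f.memLp.star.integrable_mul g.memLp

theorem volume_absolutelyContinuous_fockMeasure : (volume : Measure ℂ) ≪ fockMeasure := by
  refine withDensity_absolutelyContinuous' (by fun_prop) (Filter.Eventually.of_forall fun z => ?_)
  have : 0 < Real.pi⁻¹ * Real.exp (-‖z‖ ^ 2) := by positivity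
  simpa using this

/-- The inner product `⟨f, g⟩ = π⁻¹ ∫ f(z) conj(g(z)) e^{-|z|²} dV(z)` of Fock space, in the
convention of Mathlib (conjugate-linear in the left slot). -/
@[reducible]
def innerCore : InnerProductSpace.Core ℂ FockSpace where
  inner f g := ∫ z, conj (f z) * g z ∂fockMeasure
  conj_inner_symm f g := by
    rw [← integral_conj]
    simp [mul_comm]
  re_inner_nonneg f := by
    have h : (fun z => conj (f z) * f z) = fun z => ((‖f z‖ ^ 2 : ℝ) : ℂ) := by
      funext z
      simp [Complex.conj_mul']
    rw [h, integral_complex_ofReal]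
    exact integral_nonneg fun z => by positivity
  add_left f g h := by
    simp only [add_apply, map_add, add_mul]
    exact integral_add (integrable_conj_mul f h) (integrable_conj_mul g h)
  smul_left f g r := by
    simp only [smul_apply, map_mul, mul_assoc]
    exact integral_const_mul _ _
  definite f hf := by
    have h : (fun z => conj (f z) * f z) = fun z => ((‖f z‖ ^ 2 : ℝ) : ℂ) := by
      funext z
      simp [Complex.conj_mul']
    change ∫ z, conj (f z) * f z ∂fockMeasure = 0 at hf
    have hi : Integrable (fun z => ‖f z‖ ^ 2) fockMeasure := f.memLp.integrable_norm_pow two_ne_zero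
    rw [h, integral_complex_ofReal, Complex.ofReal_eq_zero,
      integral_eq_zero_iff_of_nonneg (fun z => by positivity) hi] at hf
    have h0 := volume_absolutelyContinuous_fockMeasure.ae_le hf
    have h1 : (fun z => ‖f z‖ ^ 2) = fun _ => (0 : ℝ) :=
      (f.differentiable.continuous.norm.pow 2).ae_eq_iff_eq volume continuous_const |>.1 h0
    refine DFunLike.ext _ _ fun z => ?_
    simpa using congrFun h1 z

instance : NormedAddCommGroup FockSpace :=
  @InnerProductSpace.Core.toNormedAddCommGroup ℂ FockSpace _ _ _ innerCore

instance : InnerProductSpace ℂ FockSpace :=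
  InnerProductSpace.ofCore innerCore.toCore

theorem inner_def (f g : FockSpace) : inner ℂ f g = ∫ z, conj (f z) * g z ∂fockMeasure := rfl

end FockSpace

/-! ### Weighted composition conjugations on Fock space -/

/-- The condition on the complex parameters under which the anti-linear weighted composition
operator is a conjugation on Fock space. -/
def IsConjugationParam (a b c : ℂ) : Prop :=
  ‖a‖ = 1 ∧ conj a * b + conj b = 0 ∧ ‖c‖ ^ 2 * Real.exp (‖b‖ ^ 2) = 1

theorem isConjugationParam_one : IsConjugationParam 1 0 1 := by
  simp [IsConjugationParam]

theorem isConjugationParam_neg_one : IsConjugationParam (-1) 0 1 := by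
  simp [IsConjugationParam]

theorem measurePreserving_conj_affine {a : ℂ} (b : ℂ) (ha : ‖a‖ = 1) :
    MeasurePreserving (fun z : ℂ => conj (a * z + b)) := by
  have h1 := (rotation ⟨a, by simp [Submonoid.unitSphere, ha]⟩).measurePreserving
  have h2 := measurePreserving_add_right (volume : Measure ℂ) b
  have h3 := Complex.conjLIE.measurePreserving
  exact h3.comp (h2.comp h1)

theorem memLp_fockMeasure_iff {f : ℂ → ℂ} (hf : Continuous f) :
    MemLp f 2 fockMeasure ↔
      Integrable fun z => ‖f z‖ ^ 2 * (Real.pi⁻¹ * Real.exp (-‖z‖ ^ 2)) := by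
  rw [memLp_two_iff_integrable_sq_norm hf.aestronglyMeasurable, fockMeasure,
    integrable_withDensity_iff (by fun_prop) (by simp)]
  refine integrable_congr (Filter.Eventually.of_forall fun z => ?_)
  have : 0 ≤ Real.pi⁻¹ * Real.exp (-‖z‖ ^ 2) := by positivity
  simp only [ENNReal.toReal_ofReal this]

theorem IsConjugationParam.weight {a b c : ℂ} (h : IsConjugationParam a b c) (z : ℂ) :
    ‖c * Complex.exp (b * z)‖ ^ 2 * Real.exp (-‖z‖ ^ 2) = Real.exp (-‖conj (a * z + b)‖ ^ 2) := by
  obtain ⟨ha, hab, hc⟩ := h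
  have haa : a * conj a = 1 := by simp [Complex.mul_conj', ha]
  have hb : a * conj b = -b := by linear_combination a * hab - b * haa
  have hn : ‖a * z + b‖ ^ 2 = ‖z‖ ^ 2 + ‖b‖ ^ 2 - 2 * (b * z).re := by
    have e : (a * z) * conj b = -(b * z) := by linear_combination z * hb
    rw [Complex.sq_norm, Complex.normSq_add, e, ← Complex.sq_norm, ← Complex.sq_norm, norm_mul, ha]
    simp
    ring
  rw [RCLike.norm_conj, hn, norm_mul, Complex.norm_exp, mul_pow, ← Real.exp_nat_mul]
  have hc' : ‖c‖ ^ 2 = Real.exp (-‖b‖ ^ 2) := by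
    rw [Real.exp_neg]
    exact eq_inv_of_mul_eq_one_left hc
  rw [hc', ← Real.exp_add, ← Real.exp_add]
  congr 1
  push_cast
  ring

/-- The weighted composition conjugation
`𝒞_{a,b,c} f (z) = c e^{bz} conj (f (conj (a z + b)))` as a map of Fock space to itself. -/
def weightedCompConj (a b c : ℂ) (h : IsConjugationParam a b c) (f : FockSpace) : FockSpace :=
  FockSpace.mk (fun z => c * Complex.exp (b * z) * conj (f (conj (a * z + b))))
    (by
      have h1 : Differentiable ℂ fun w : ℂ => conj (f (conj w)) := by
        intro w
        have := (f.differentiable (conj w)).conj_conj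
        simpa [Function.comp_def] using this
      have h2 : Differentiable ℂ fun z : ℂ => a * z + b := by fun_prop
      have h3 : Differentiable ℂ fun z : ℂ => c * Complex.exp (b * z) := by fun_prop
      exact h3.mul (h1.comp h2))
    (by
      have hf := f.differentiable.continuous
      have hcont : Continuous fun z : ℂ =>
          c * Complex.exp (b * z) * conj (f (conj (a * z + b))) := by fun_prop
      rw [memLp_fockMeasure_iff hcont]
      have h1 := (memLp_fockMeasure_iff hf).1 f.memLp
      have h2 := (measurePreserving_conj_affine b h.1).integrable_comp_of_integrable h1
      refine h2.congr (Filter.Eventually.of_forall fun z => ?_)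
      simp only [Function.comp_apply]
      rw [← h.weight z, norm_mul (c * Complex.exp (b * z)), RCLike.norm_conj]
      ring)

/-! ### The Segal–Bargmann transform and the two conjugations on `L²(ℝ)` -/

/-- The kernel `A(z, x) = π^{-1/4} e^{(-z² + 2√2 x z - x²)/2}`. -/
def segalBargmannKernel (z : ℂ) (x : ℝ) : ℂ :=
  ((Real.pi ^ (-(1 / 4) : ℝ) : ℝ) : ℂ) *
    Complex.exp ((-z ^ 2 + 2 * (Real.sqrt 2 : ℂ) * (x : ℂ) * z - (x : ℂ) ^ 2) / 2)

/-- The function `z ↦ ∫ A(z, x) f(x) dx` on the complex plane. -/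
def segalBargmann (f : Lp ℂ 2 (volume : Measure ℝ)) (z : ℂ) : ℂ :=
  ∫ x : ℝ, segalBargmannKernel z x * f x

/-- The time-reversal operator `f ↦ conj (f (x))` on `L²(ℝ)`. -/
def timeReversal (f : Lp ℂ 2 (volume : Measure ℝ)) : Lp ℂ 2 (volume : Measure ℝ) := star f

/-- The operator `f ↦ conj (f (-x))` on `L²(ℝ)`. -/
def parityTime (f : Lp ℂ 2 (volume : Measure ℝ)) : Lp ℂ 2 (volume : Measure ℝ) :=
  star (Lp.compMeasurePreserving (fun x : ℝ => -x) (Measure.measurePreserving_neg volume) f)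

theorem timeReversal_ae (f : Lp ℂ 2 (volume : Measure ℝ)) :
    ∀ᵐ x, timeReversal f x = conj (f x) :=
  Lp.coeFn_star f

theorem parityTime_ae (f : Lp ℂ 2 (volume : Measure ℝ)) :
    ∀ᵐ x, parityTime f x = conj (f (-x)) := by
  have hm := Measure.measurePreserving_neg (volume : Measure ℝ)
  filter_upwards [Lp.coeFn_star (Lp.compMeasurePreserving (fun x : ℝ => -x) hm f),
    Lp.coeFn_compMeasurePreserving f hm] with x h1 h2
  change (star (Lp.compMeasurePreserving (fun x : ℝ => -x) hm f) : Lp ℂ 2 volume) x = _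
  rw [h1, Pi.star_apply, h2]
  rfl

theorem weightedCompConj_apply (a b c : ℂ) (h : IsConjugationParam a b c) (f : FockSpace) (z : ℂ) :
    weightedCompConj a b c h f z = c * Complex.exp (b * z) * conj (f (conj (a * z + b))) := rfl

end

open scoped FourierTransform SchwartzMap ContDiff

/-! Differentiation under the integral makes `segalBargmann f` entire. On each line re z = s it is,
up to an explicit factor, the Fourier transform of f times a Gaussian; Plancherel in im z followed
by a normalized Gaussian integral in s gives the isometry (`lintegral_enorm_segalBargmann_sq`).

The range is complete, hence closed. It contains every reproducing kernel e^{z conj w}, the image of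
conj A(w, ·), so a function orthogonal to it vanishes at every w
(`integral_conj_exp_mul_fockMeasure`).

The two conjugation identities express symmetries of the kernel: conj A(z, x) = A(conj z, x) and
A(z, -x) = A(-z, x). -/

/-! ### Plancherel on L¹ ∩ L² and real Gaussian integrals -/

theorem eLpNorm_two_sq {α E : Type*} [MeasurableSpace α] [NormedAddCommGroup E] (f : α → E)
    (μ : Measure α) : eLpNorm f 2 μ ^ 2 = ∫⁻ x, ‖f x‖ₑ ^ 2 ∂μ := by
  have h := eLpNorm_nnreal_pow_eq_lintegral (f := f) (μ := μ) (p := 2) two_ne_zero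
  simpa using h

/-- The integral Fourier transform of a function in `L¹ ∩ L²` is its `L²` Fourier transform. -/
theorem fourier_ae_eq_fourier_toLp {g : ℝ → ℂ} (h1 : Integrable g) (h2 : MemLp g 2) :
    𝓕 g =ᵐ[volume] (𝓕 (h2.toLp g) : Lp ℂ 2 (volume : Measure ℝ)) := by
  have hc : Continuous (𝓕 g) :=
    VectorFourier.fourierIntegral_continuous Real.continuous_fourierChar
      (by exact continuous_inner) h1
  -- Both sides are compared as distributions: against a test function, either transform can be
  -- moved onto the test function (`e3`, `e4`).
  refine ae_eq_of_integral_contDiff_smul_eq hc.locallyIntegrable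
    ((Lp.memLp _).locallyIntegrable (by norm_num)) fun φ hφ hφc => ?_
  have hs : HasCompactSupport (Complex.ofRealCLM ∘ φ) := hφc.comp_left rfl
  have hd : ContDiff ℝ ∞ (Complex.ofRealCLM ∘ φ) := by fun_prop
  set ψ : 𝓢(ℝ, ℂ) := hs.toSchwartzMap hd with hψ
  have e1 : ∫ x, φ x • (𝓕 g) x = ∫ x, ψ x • (𝓕 g) x :=
    integral_congr_ae (.of_forall fun x => by simp [hψ])
  have e2 : ∫ x, φ x • (𝓕 (h2.toLp g) : Lp ℂ 2 (volume : Measure ℝ)) x =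
      ∫ x, ψ x • (𝓕 (h2.toLp g) : Lp ℂ 2 (volume : Measure ℝ)) x :=
    integral_congr_ae (.of_forall fun x => by simp [hψ])
  have e3 : ∫ x, (𝓕 ψ) x • g x = ∫ x, ψ x • (𝓕 g) x := by
    simpa using! VectorFourier.integral_bilin_fourierIntegral_eq_flip (.lsmul ℂ ℂ)
      (L := innerₗ ℝ) Real.continuous_fourierChar continuous_inner ψ.integrable h1
  have e4 := congrArg (fun T => T ψ) (Lp.fourier_toTemperedDistribution_eq (h2.toLp g))
  simp only [TemperedDistribution.fourier_apply, Lp.toTemperedDistribution_apply] at e4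
  rw [e1, e2, ← e4, ← e3]
  refine integral_congr_ae ?_
  filter_upwards [h2.coeFn_toLp] with x hx
  rw [hx]

/-- **Plancherel's theorem** on `L¹ ∩ L²`. -/
theorem lintegral_enorm_fourier_sq {g : ℝ → ℂ} (h1 : Integrable g) (h2 : MemLp g 2) :
    ∫⁻ ξ, ‖(𝓕 g) ξ‖ₑ ^ 2 = ∫⁻ x, ‖g x‖ₑ ^ 2 := by
  rw [← eLpNorm_two_sq, ← eLpNorm_two_sq, eLpNorm_congr_ae (fourier_ae_eq_fourier_toLp h1 h2),
    ← Lp.enorm_def, ← Lp.enorm_toLp (hf := h2), ← ofReal_norm, ← ofReal_norm, Lp.norm_fourier_eq]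

theorem lintegral_comp_mul_left_real {a : ℝ} (ha : a ≠ 0) (f : ℝ → ℝ≥0∞) (hf : Measurable f) :
    ∫⁻ x, f (a * x) = ENNReal.ofReal |a⁻¹| * ∫⁻ x, f x := by
  rw [← lintegral_map hf (measurable_const_mul a), Real.map_volume_mul_left ha,
    lintegral_smul_measure, smul_eq_mul]

theorem lintegral_gaussian_sub (a : ℝ) {b : ℝ} (hb : 0 < b) :
    ∫⁻ x : ℝ, ENNReal.ofReal (Real.exp (-b * (x - a) ^ 2)) =
      ENNReal.ofReal (Real.sqrt (Real.pi / b)) := by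
  rw [lintegral_sub_right_eq_self (fun x => ENNReal.ofReal (Real.exp (-b * x ^ 2))) a,
    ← ofReal_integral_eq_lintegral_ofReal (integrable_exp_neg_mul_sq hb)
      (.of_forall fun x => (Real.exp_pos _).le), integral_gaussian]

/-! ### The Gaussian measure: mean value and reproducing property -/

theorem integral_fockMeasure (f : ℂ → ℂ) :
    ∫ z, f z ∂fockMeasure = ∫ z, (Real.pi⁻¹ * Real.exp (-‖z‖ ^ 2)) • f z := by
  rw [fockMeasure, integral_withDensity_eq_integral_toReal_smul (by fun_prop) (by simp)]
  refine integral_congr_ae (.of_forall fun z => ?_)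
  have : 0 ≤ Real.pi⁻¹ * Real.exp (-‖z‖ ^ 2) := by positivity
  simp only [ENNReal.toReal_ofReal this]

theorem integrable_fockMeasure_iff (f : ℂ → ℂ) :
    Integrable f fockMeasure ↔
      Integrable fun z => (Real.pi⁻¹ * Real.exp (-‖z‖ ^ 2)) • f z := by
  rw [fockMeasure, integrable_withDensity_iff_integrable_smul' (by fun_prop) (by simp)]
  refine integrable_congr (.of_forall fun z => ?_)
  have : 0 ≤ Real.pi⁻¹ * Real.exp (-‖z‖ ^ 2) := by positivity
  simp only [ENNReal.toReal_ofReal this]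

instance : IsProbabilityMeasure fockMeasure := by
  have hi : ∫ z : ℂ, Real.exp (-1 * ‖z‖ ^ 2) = Real.pi := by
    rw [GaussianFourier.integral_rexp_neg_mul_sq_norm one_pos]
    simp
  have hint : Integrable fun z : ℂ => Real.exp (-1 * ‖z‖ ^ 2) := by
    -- A non-integrable function would have integral 0, not π.
    by_contra h
    rw [integral_undef h] at hi
    exact Real.pi_ne_zero hi.symm
  refine ⟨?_⟩
  rw [fockMeasure, withDensity_apply _ .univ, Measure.restrict_univ,
    ← ofReal_integral_eq_lintegral_ofReal, integral_const_mul]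
  · simp only [neg_mul, one_mul] at hi
    rw [hi, inv_mul_cancel₀ Real.pi_ne_zero, ENNReal.ofReal_one]
  · simpa using hint.const_mul Real.pi⁻¹
  · exact .of_forall fun z => by positivity

theorem measurePreserving_rotation_fockMeasure (a : Circle) :
    MeasurePreserving (rotation a) fockMeasure fockMeasure := by
  refine ⟨(rotation a).continuous.measurable, ?_⟩
  ext s hs
  have hm := (rotation a).continuous.measurable
  rw [Measure.map_apply hm hs, fockMeasure, withDensity_apply _ (hm hs), withDensity_apply _ hs,
    ← (rotation a).measurePreserving.setLIntegral_comp_preimage hs (by fun_prop)]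
  simp only [LinearIsometryEquiv.norm_map]

/-- The mean value property of entire functions for the Gaussian measure. -/
theorem integral_fockMeasure_eq_apply_zero {f : ℂ → ℂ} (hf : Differentiable ℂ f)
    (hi : Integrable f fockMeasure) : ∫ z, f z ∂fockMeasure = f 0 := by
  -- Rotations preserve the Gaussian measure, so averaging over them leaves the integral unchanged;
  -- Fubini then reduces the claim to the mean value property on circles.
  let ν : Measure ℝ := volume.restrict (Set.Ioc 0 (2 * Real.pi))
  have hrot (θ : ℝ) := measurePreserving_rotation_fockMeasure (Circle.exp θ)
  have hmap (θ : ℝ) (z : ℂ) : rotation (Circle.exp θ) z = Complex.exp (θ * Complex.I) * z := by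
    simp [Circle.coe_exp]
  have hrotint (θ : ℝ) : Integrable (fun z => f (Complex.exp (θ * Complex.I) * z)) fockMeasure := by
    simpa only [Function.comp_def, hmap] using (hrot θ).integrable_comp_of_integrable hi
  have hemb (θ : ℝ) : MeasurableEmbedding (rotation (Circle.exp θ)) :=
    (rotation (Circle.exp θ)).toHomeomorph.measurableEmbedding
  have hcont : Continuous fun p : ℝ × ℂ => f (Complex.exp (p.1 * Complex.I) * p.2) :=
    hf.continuous.comp (by fun_prop)
  have hprod : Integrable (fun p : ℝ × ℂ => f (Complex.exp (p.1 * Complex.I) * p.2))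
      (ν.prod fockMeasure) := by
    rw [integrable_prod_iff hcont.aestronglyMeasurable]
    refine ⟨.of_forall hrotint, ?_⟩
    have : (fun θ : ℝ => ∫ z, ‖f (Complex.exp (θ * Complex.I) * z)‖ ∂fockMeasure) =
        fun _ => ∫ z, ‖f z‖ ∂fockMeasure := by
      funext θ
      simpa only [hmap] using (hrot θ).integral_comp (hemb θ) fun z => ‖f z‖
    simp only [this]
    exact integrable_const _
  have hswap := integral_integral_swap
    (f := fun (θ : ℝ) (z : ℂ) => f (Complex.exp (θ * Complex.I) * z)) hprod
  have hl (θ : ℝ) : ∫ z, f (Complex.exp (θ * Complex.I) * z) ∂fockMeasure =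
      ∫ z, f z ∂fockMeasure := by
    simpa only [hmap] using (hrot θ).integral_comp (hemb θ) f
  -- Rotating z by θ traces the circle of radius ‖z‖ starting at angle arg z.
  have hr (z : ℂ) : ∫ θ, f (Complex.exp (θ * Complex.I) * z) ∂ν = (2 * Real.pi) • f 0 := by
    have hz : z = ‖z‖ * Complex.exp (z.arg * Complex.I) := (Complex.norm_mul_exp_arg_mul_I z).symm
    have hav := (hf.diffContOnCl (s := Metric.ball 0 |‖z‖|)).circleAverage
    have h0 := Real.circleAverage_eq_integral_add (f := f) (c := 0) (R := ‖z‖) z.arg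
    rw [hav] at h0
    rw [h0, smul_inv_smul₀ (by positivity), intervalIntegral.integral_of_le (by positivity)]
    refine integral_congr_ae (.of_forall fun θ => ?_)
    simp only [circleMap, zero_add]
    congr 1
    conv_lhs => rw [hz]
    push_cast
    rw [add_mul, Complex.exp_add]
    ring
  simp only [hl, hr, integral_const] at hswap
  have hν : ν.real Set.univ = 2 * Real.pi := by
    simp [ν, Measure.real, Real.pi_pos.le]
  rw [hν] at hswap
  simpa [Real.pi_ne_zero] using hswap

/-- The reproducing property of the kernel `e^{z conj w}` of Fock space. -/
theorem integral_conj_exp_mul_fockMeasure {f : ℂ → ℂ} (hf : Differentiable ℂ f) (w : ℂ)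
    (hi : Integrable (fun z => conj (Complex.exp (z * conj w)) * f z) fockMeasure) :
    ∫ z, conj (Complex.exp (z * conj w)) * f z ∂fockMeasure = f w := by
  -- Translation by w turns weight times kernel into the weight times the entire function e^{-z conj
  -- w}, which equals 1 at 0; the mean value property then returns f(w).
  have key (z : ℂ) : (Real.pi⁻¹ * Real.exp (-‖z + w‖ ^ 2)) •
        (conj (Complex.exp ((z + w) * conj w)) * f (z + w)) =
      (Real.pi⁻¹ * Real.exp (-‖z‖ ^ 2)) • (Complex.exp (-z * conj w) * f (z + w)) := by
    have e : ((Real.exp (-‖z + w‖ ^ 2) : ℝ) : ℂ) * conj (Complex.exp ((z + w) * conj w)) =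
        ((Real.exp (-‖z‖ ^ 2) : ℝ) : ℂ) * Complex.exp (-z * conj w) := by
      rw [← Complex.exp_conj]
      push_cast
      rw [← Complex.conj_mul', ← Complex.conj_mul', ← Complex.exp_add, ← Complex.exp_add]
      congr 1
      simp
      ring
    simp only [Complex.real_smul, Complex.ofReal_mul]
    linear_combination ((Real.pi⁻¹ : ℝ) : ℂ) * f (z + w) * e
  have hd : Differentiable ℂ fun z => Complex.exp (-z * conj w) * f (z + w) := by fun_prop
  have hg : Integrable (fun z => Complex.exp (-z * conj w) * f (z + w)) fockMeasure := by
    rw [integrable_fockMeasure_iff] at hi ⊢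
    refine (hi.comp_add_right w).congr (.of_forall key)
  have h := integral_fockMeasure_eq_apply_zero hd hg
  rw [integral_fockMeasure] at h ⊢
  rw [← integral_add_right_eq_self _ w]
  simp only [key]
  simpa using h

/-! ### Kernel estimates and holomorphy of the transform -/

theorem norm_segalBargmannKernel (z : ℂ) (x : ℝ) :
    ‖segalBargmannKernel z x‖ = Real.pi ^ (-(1 / 4) : ℝ) *
      Real.exp ((-(z.re ^ 2 - z.im ^ 2) + 2 * Real.sqrt 2 * x * z.re - x ^ 2) / 2) := by
  rw [segalBargmannKernel, norm_mul, Complex.norm_exp, Complex.norm_real, Real.norm_of_nonneg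
    (by positivity)]
  congr 2
  have : (-z ^ 2 + 2 * (Real.sqrt 2 : ℂ) * (x : ℂ) * z - (x : ℂ) ^ 2) / 2 =
      (((-(z.re ^ 2 - z.im ^ 2) + 2 * Real.sqrt 2 * x * z.re - x ^ 2) / 2 : ℝ) : ℂ) +
      ((-z.re * z.im + Real.sqrt 2 * x * z.im : ℝ) : ℂ) * Complex.I := by
    conv_lhs => rw [← Complex.re_add_im z]
    push_cast
    linear_combination (-(z.im : ℂ) ^ 2 / 2) * Complex.I_sq
  rw [this]
  simp only [Complex.add_re, Complex.ofReal_re, Complex.re_ofReal_mul, Complex.I_re, mul_zero,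
    add_zero]

/-- Completing the square costs half of the decay e^{-x²/2} and leaves a bound uniform on the disc,
as domination requires. The constant 3 is not sharp. -/
theorem norm_segalBargmannKernel_le {z : ℂ} {R : ℝ} (hz : ‖z‖ ≤ R) (x : ℝ) :
    ‖segalBargmannKernel z x‖ ≤
      Real.pi ^ (-(1 / 4) : ℝ) * Real.exp (3 * R ^ 2) * Real.exp (-x ^ 2 / 4) := by
  rw [norm_segalBargmannKernel, mul_assoc (Real.pi ^ (-(1 / 4) : ℝ)), ← Real.exp_add]
  gcongr
  have h1 : z.re ^ 2 ≤ R ^ 2 := sq_le_sq' (by linarith [neg_abs_le z.re, Complex.abs_re_le_norm z])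
    (by linarith [le_abs_self z.re, Complex.abs_re_le_norm z])
  have h2 : z.im ^ 2 ≤ R ^ 2 := sq_le_sq' (by linarith [neg_abs_le z.im, Complex.abs_im_le_norm z])
    (by linarith [le_abs_self z.im, Complex.abs_im_le_norm z])
  have h3 : Real.sqrt 2 ^ 2 = 2 := Real.sq_sqrt (by norm_num)
  nlinarith [sq_nonneg (x / 2 - Real.sqrt 2 * z.re)]

@[fun_prop]
theorem continuous_segalBargmannKernel (z : ℂ) : Continuous (segalBargmannKernel z) := by
  unfold segalBargmannKernel
  fun_prop

theorem hasDerivAt_segalBargmannKernel (z : ℂ) (x : ℝ) :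
    HasDerivAt (fun w => segalBargmannKernel w x)
      (segalBargmannKernel z x * (-z + Real.sqrt 2 * x)) z := by
  have h : HasDerivAt (fun z : ℂ => (-z ^ 2 + 2 * (Real.sqrt 2 : ℂ) * (x : ℂ) * z - (x : ℂ) ^ 2) / 2)
      (-z + Real.sqrt 2 * x) z := by
    have h1 := (((((hasDerivAt_id z).pow 2).neg).add
      ((hasDerivAt_id z).const_mul (2 * (Real.sqrt 2 : ℂ) * (x : ℂ)))).sub_const
        ((x : ℂ) ^ 2)).div_const 2
    refine h1.congr_deriv ?_
    simp
    ring
  have := h.cexp.const_mul ((Real.pi ^ (-(1 / 4) : ℝ) : ℝ) : ℂ)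
  refine this.congr_deriv ?_
  simp only [segalBargmannKernel]
  ring

theorem memLp_two_exp_neg_mul_sq {b : ℝ} (hb : 0 < b) :
    MemLp (fun x : ℝ => Real.exp (-b * x ^ 2)) 2 := by
  rw [memLp_two_iff_integrable_sq_norm (by fun_prop)]
  refine (integrable_exp_neg_mul_sq (b := 2 * b) (by positivity)).congr (.of_forall fun x => ?_)
  simp only [Real.norm_eq_abs, sq_abs, ← Real.exp_nat_mul]
  congr 1
  push_cast
  ring

theorem memLp_segalBargmannKernel (z : ℂ) : MemLp (segalBargmannKernel z) 2 := by
  refine ((memLp_two_exp_neg_mul_sq (b := 1 / 4) (by norm_num)).const_mul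
    (Real.pi ^ (-(1 / 4) : ℝ) * Real.exp (3 * ‖z‖ ^ 2))).of_le
      (continuous_segalBargmannKernel z).aestronglyMeasurable (.of_forall fun x => ?_)
  refine (norm_segalBargmannKernel_le le_rfl x).trans ((le_of_eq ?_).trans (le_abs_self _))
  congr 2
  ring

theorem integrable_segalBargmannKernel_mul (z : ℂ) (f : Lp ℂ 2 (volume : Measure ℝ)) :
    Integrable fun x => segalBargmannKernel z x * f x :=
  (memLp_segalBargmannKernel z).integrable_mul (Lp.memLp f)

theorem differentiable_segalBargmann (f : Lp ℂ 2 (volume : Measure ℝ)) :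
    Differentiable ℂ (segalBargmann f) := by
  intro z
  set R := ‖z‖ + 1 with hR
  set C := Real.pi ^ (-(1 / 4) : ℝ) * Real.exp (3 * R ^ 2) with hC
  have hRpos : 0 < R := by positivity
  have hfm := (Lp.memLp f).aestronglyMeasurable
  have hbound : Integrable fun x : ℝ => (C * (R + 8)) * (Real.exp (-(1 / 8) * x ^ 2) * ‖f x‖) :=
    ((memLp_two_exp_neg_mul_sq (b := 1 / 8) (by norm_num)).integrable_mul
      (Lp.memLp f).norm).const_mul _
  refine (hasDerivAt_integral_of_dominated_loc_of_deriv_le (Metric.ball_mem_nhds z one_pos)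
    (F' := fun w x => segalBargmannKernel w x * (-w + Real.sqrt 2 * x) * f x)
    (.of_forall fun w => (continuous_segalBargmannKernel w).aestronglyMeasurable.mul hfm)
    (integrable_segalBargmannKernel_mul z f) ?_ (.of_forall fun x w hw => ?_) hbound
    (.of_forall fun x w _ => (hasDerivAt_segalBargmannKernel w x).mul_const _)).2.differentiableAt
  · exact (Continuous.aestronglyMeasurable (by fun_prop)).mul hfm
  · have hw' : ‖w‖ ≤ R := by
      have h1 : ‖w - z‖ < 1 := mem_ball_iff_norm.1 hw
      have h2 := norm_add_le (w - z) z
      rw [sub_add_cancel] at h2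
      linarith
    -- Half of the exponent in e^{-x²/4} is spent on absorbing the linear factor from the
    -- derivative; e^{-x²/8} remains, still in L².
    have h2 : ‖-w + Real.sqrt 2 * (x : ℂ)‖ ≤ (R + 8) * Real.exp (1 / 8 * x ^ 2) := by
      have h3 : ‖-w + Real.sqrt 2 * (x : ℂ)‖ ≤ R + 2 * |x| := by
        refine (norm_add_le _ _).trans ?_
        rw [norm_neg, norm_mul, Complex.norm_real, Complex.norm_real, Real.norm_eq_abs x,
          Real.norm_of_nonneg (Real.sqrt_nonneg 2)]
        have : Real.sqrt 2 ≤ 2 := by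
          rw [Real.sqrt_le_left (by norm_num)]
          norm_num
        gcongr
      have h4 := Real.add_one_le_exp (1 / 8 * x ^ 2)
      have h5 : R + 2 * |x| ≤ (R + 8) * (1 / 8 * x ^ 2 + 1) := by
        nlinarith [sq_nonneg (|x| - 1), sq_abs x, mul_nonneg hRpos.le (sq_nonneg x)]
      exact h3.trans (h5.trans (by gcongr))
    rw [norm_mul, norm_mul]
    calc _ ≤ (C * Real.exp (-x ^ 2 / 4)) * ((R + 8) * Real.exp (1 / 8 * x ^ 2)) * ‖f x‖ := by
          gcongr
          exact norm_segalBargmannKernel_le hw' x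
      _ = (C * (R + 8)) * ((Real.exp (-x ^ 2 / 4) * Real.exp (1 / 8 * x ^ 2)) * ‖f x‖) := by ring
      _ = _ := by
          rw [← Real.exp_add]
          congr 4
          ring

theorem conj_segalBargmannKernel (z : ℂ) (x : ℝ) :
    conj (segalBargmannKernel z x) = segalBargmannKernel (conj z) x := by
  have h2 : conj (2 : ℂ) = 2 := Complex.conj_ofNat 2
  simp [segalBargmannKernel, ← Complex.exp_conj, h2]

/-- The kernel function `x ↦ conj (A(w, x))` is mapped to the reproducing kernel at `w`. -/
theorem integral_segalBargmannKernel_mul_conj (z w : ℂ) :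
    ∫ x, segalBargmannKernel z x * conj (segalBargmannKernel w x) =
      Complex.exp (z * conj w) := by
  have h (x : ℝ) : segalBargmannKernel z x * conj (segalBargmannKernel w x) =
      ((Real.pi ^ (-(1 / 2) : ℝ) : ℝ) : ℂ) * Complex.exp ((-1) * x ^ 2 +
        Real.sqrt 2 * (z + conj w) * x + (-(z ^ 2 + conj w ^ 2) / 2)) := by
    have hp : Real.pi ^ (-(1 / 2) : ℝ) = Real.pi ^ (-(1 / 4) : ℝ) * Real.pi ^ (-(1 / 4) : ℝ) := by
      rw [← Real.rpow_add Real.pi_pos]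
      norm_num
    rw [conj_segalBargmannKernel, segalBargmannKernel, segalBargmannKernel, hp, Complex.ofReal_mul, mul_mul_mul_comm, ← Complex.exp_add]
    congr 2
    ring
  simp only [h]
  rw [integral_const_mul, integral_cexp_quadratic (by simp)]
  have h2 : (Real.sqrt 2 : ℂ) ^ 2 = 2 := by
    rw [← Complex.ofReal_pow, Real.sq_sqrt (by norm_num)]
    norm_num
  have h3 : ((Real.pi ^ (-(1 / 2) : ℝ) : ℝ) : ℂ) * ((Real.pi : ℂ) / - -1) ^ (1 / 2 : ℂ) = 1 := by
    have : (1 / 2 : ℂ) = ((1 / 2 : ℝ) : ℂ) := by norm_num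
    rw [neg_neg, div_one, this, ← Complex.ofReal_cpow Real.pi_pos.le, ← Complex.ofReal_mul,
      ← Real.rpow_add Real.pi_pos]
    simp
  rw [← mul_assoc, h3, one_mul]
  congr 1
  linear_combination ((z + conj w) ^ 2 / 4) * h2

/-! ### The isometry, by Plancherel on vertical lines -/

/-- The function whose Fourier transform gives `segalBargmann f` on the line `re z = s`. -/
noncomputable def gaussianTilt (f : ℝ → ℂ) (s x : ℝ) : ℂ :=
  (Real.exp (Real.sqrt 2 * s * x - x ^ 2 / 2) : ℂ) * f x

theorem exp_tilt_le (s x : ℝ) :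
    Real.exp (Real.sqrt 2 * s * x - x ^ 2 / 2) ≤ Real.exp (2 * s ^ 2) * Real.exp (-(1 / 4) * x ^ 2) := by
  rw [← Real.exp_add]
  gcongr
  have h3 : Real.sqrt 2 ^ 2 = 2 := Real.sq_sqrt (by norm_num)
  nlinarith [sq_nonneg (x / 2 - Real.sqrt 2 * s)]

theorem memLp_two_tilt (s : ℝ) :
    MemLp (fun x : ℝ => (Real.exp (Real.sqrt 2 * s * x - x ^ 2 / 2) : ℂ)) 2 := by
  refine ((memLp_two_exp_neg_mul_sq (b := 1 / 4) (by norm_num)).const_mul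
    (Real.exp (2 * s ^ 2))).of_le (Continuous.aestronglyMeasurable (by fun_prop))
      (.of_forall fun x => ?_)
  rw [Complex.norm_real, Real.norm_of_nonneg (Real.exp_pos _).le]
  exact (exp_tilt_le s x).trans (le_abs_self _)

theorem integrable_gaussianTilt {f : ℝ → ℂ} (hf : MemLp f 2) (s : ℝ) :
    Integrable (gaussianTilt f s) :=
  (memLp_two_tilt s).integrable_mul hf

theorem memLp_gaussianTilt {f : ℝ → ℂ} (hf : MemLp f 2) (s : ℝ) :
    MemLp (gaussianTilt f s) 2 := by
  refine hf.of_le_mul (c := Real.exp (2 * s ^ 2))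
    ((integrable_gaussianTilt hf s).aestronglyMeasurable) (.of_forall fun x => ?_)
  rw [gaussianTilt, norm_mul, Complex.norm_real, Real.norm_of_nonneg (Real.exp_pos _).le]
  refine mul_le_mul_of_nonneg_right ?_ (norm_nonneg _)
  refine (exp_tilt_le s x).trans (mul_le_of_le_one_right (Real.exp_pos _).le ?_)
  rw [Real.exp_le_one_iff]
  nlinarith [sq_nonneg x]

/-- On the line re z = s the x-dependence of the kernel splits into a real Gaussian tilt and the
character e^{i√2 x t}. The frequency -√2 t/(2π) matches the convention e^{-2πi x ξ} of `𝓕`. -/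
theorem segalBargmann_eq_fourier (f : Lp ℂ 2 (volume : Measure ℝ)) (s t : ℝ) :
    segalBargmann f (s + t * Complex.I) =
      ((Real.pi ^ (-(1 / 4) : ℝ) : ℝ) : ℂ) * Complex.exp (-(s + t * Complex.I) ^ 2 / 2) *
        (𝓕 (gaussianTilt f s)) (-(Real.sqrt 2 / (2 * Real.pi)) * t) := by
  rw [Real.fourier_real_eq_integral_exp_smul, ← integral_const_mul, segalBargmann]
  refine integral_congr_ae (.of_forall fun x => ?_)
  have e : -2 * Real.pi * x * (-(Real.sqrt 2 / (2 * Real.pi)) * t) = Real.sqrt 2 * x * t := by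
    field_simp
  simp only [e, gaussianTilt, segalBargmannKernel, smul_eq_mul, Complex.ofReal_exp]
  have h : Complex.exp ((-(s + t * Complex.I) ^ 2 + 2 * (Real.sqrt 2 : ℂ) * x * (s + t * Complex.I) -
      (x : ℂ) ^ 2) / 2) = Complex.exp (-(s + t * Complex.I) ^ 2 / 2) *
        (Complex.exp ((Real.sqrt 2 * x * t : ℝ) * Complex.I) *
          Complex.exp ((Real.sqrt 2 * s * x - x ^ 2 / 2 : ℝ) : ℂ)) := by
    rw [← Complex.exp_add, ← Complex.exp_add]
    congr 1
    push_cast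
    ring
  rw [h]
  ring

theorem enorm_sq_eq_ofReal (z : ℂ) : ‖z‖ₑ ^ 2 = ENNReal.ofReal (‖z‖ ^ 2) := by
  rw [← ofReal_norm, ENNReal.ofReal_pow (norm_nonneg z)]

/-- The factor e^{t²} from |e^{-z²/2}|² cancels e^{-t²} in the weight, so t survives only in the
Fourier transform and Plancherel applies in t. -/
theorem weight_mul_enorm_segalBargmann_sq (f : Lp ℂ 2 (volume : Measure ℝ)) (s t : ℝ) :
    ENNReal.ofReal (Real.pi⁻¹ * Real.exp (-‖(s + t * Complex.I : ℂ)‖ ^ 2)) *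
        ‖segalBargmann f (s + t * Complex.I)‖ₑ ^ 2 =
      ENNReal.ofReal (Real.pi⁻¹ * Real.pi ^ (-(1 / 2) : ℝ) * Real.exp (-2 * s ^ 2)) *
        ‖(𝓕 (gaussianTilt f s)) (-(Real.sqrt 2 / (2 * Real.pi)) * t)‖ₑ ^ 2 := by
  rw [segalBargmann_eq_fourier, enorm_mul, mul_pow, ← mul_assoc, enorm_sq_eq_ofReal (_ * _),
    ← ENNReal.ofReal_mul (by positivity)]
  congr 2
  have hre : (-(s + t * Complex.I : ℂ) ^ 2 / 2).re = -(s ^ 2 - t ^ 2) / 2 := by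
    have : -(s + t * Complex.I : ℂ) ^ 2 / 2 =
        ((-(s ^ 2 - t ^ 2) / 2 : ℝ) : ℂ) + ((-s * t : ℝ) : ℂ) * Complex.I := by
      push_cast
      linear_combination (-(t : ℂ) ^ 2 / 2) * Complex.I_sq
    rw [this]
    simp only [Complex.add_re, Complex.ofReal_re, Complex.re_ofReal_mul, Complex.I_re, mul_zero,
      add_zero]
  have hp : Real.pi ^ (-(1 / 2) : ℝ) = (Real.pi ^ (-(1 / 4) : ℝ)) ^ 2 := by
    rw [← Real.rpow_natCast, ← Real.rpow_mul Real.pi_pos.le]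
    norm_num
  have he : Real.exp (-‖(s + t * Complex.I : ℂ)‖ ^ 2) * Real.exp (-(s ^ 2 - t ^ 2) / 2) ^ 2 =
      Real.exp (-2 * s ^ 2) := by
    rw [← Real.exp_nat_mul, ← Real.exp_add, Complex.sq_norm, Complex.normSq_add_mul_I]
    congr 1
    push_cast
    ring
  rw [norm_mul, Complex.norm_exp, hre, Complex.norm_real, Real.norm_of_nonneg (by positivity), hp,
    ← he]
  ring

/-- The integrand is a Gaussian density in s centred at x√2/2. The factor 2π/√2 is the Jacobian of
the frequency rescaling. -/
theorem lintegral_tilt_weight (x : ℝ) :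
    ∫⁻ s : ℝ, ENNReal.ofReal (Real.pi⁻¹ * Real.pi ^ (-(1 / 2) : ℝ) * Real.exp (-2 * s ^ 2) *
        (2 * Real.pi / Real.sqrt 2) * Real.exp (Real.sqrt 2 * s * x - x ^ 2 / 2) ^ 2) = 1 := by
  have h2 : Real.sqrt 2 ^ 2 = 2 := Real.sq_sqrt (by norm_num)
  have e (s : ℝ) : Real.pi⁻¹ * Real.pi ^ (-(1 / 2) : ℝ) * Real.exp (-2 * s ^ 2) *
        (2 * Real.pi / Real.sqrt 2) * Real.exp (Real.sqrt 2 * s * x - x ^ 2 / 2) ^ 2 =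
      (Real.pi ^ (-(1 / 2) : ℝ) * Real.sqrt 2) * Real.exp (-2 * (s - Real.sqrt 2 / 2 * x) ^ 2) := by
    have h : Real.exp (-2 * (s - Real.sqrt 2 / 2 * x) ^ 2) =
        Real.exp (-2 * s ^ 2) * Real.exp (Real.sqrt 2 * s * x - x ^ 2 / 2) ^ 2 := by
      rw [← Real.exp_nat_mul, ← Real.exp_add]
      congr 1
      push_cast
      linear_combination (-x ^ 2 / 2) * h2
    have h4 : Real.pi⁻¹ * (2 * Real.pi / Real.sqrt 2) = Real.sqrt 2 := by
      field_simp
      exact h2.symm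
    rw [h]
    linear_combination Real.pi ^ (-(1 / 2) : ℝ) * Real.exp (-2 * s ^ 2) *
      Real.exp (Real.sqrt 2 * s * x - x ^ 2 / 2) ^ 2 * h4
  simp only [e]
  have hp : 0 ≤ Real.pi ^ (-(1 / 2) : ℝ) * Real.sqrt 2 := by positivity
  simp only [ENNReal.ofReal_mul hp]
  rw [lintegral_const_mul _ (by fun_prop), lintegral_gaussian_sub _ two_pos,
    ← ENNReal.ofReal_mul hp, ← ENNReal.ofReal_one]
  congr 1
  rw [Real.sqrt_div Real.pi_pos.le, Real.rpow_neg Real.pi_pos.le, ← Real.sqrt_eq_rpow]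
  field_simp

/-- Lower Lebesgue integrals allow Tonelli without knowing beforehand that the transform is square
integrable; that follows from this identity. -/
theorem lintegral_enorm_segalBargmann_sq (f : Lp ℂ 2 (volume : Measure ℝ)) :
    ∫⁻ z, ‖segalBargmann f z‖ₑ ^ 2 ∂fockMeasure = ∫⁻ x, ‖f x‖ₑ ^ 2 := by
  have hm : Measurable (segalBargmann f) := (differentiable_segalBargmann f).continuous.measurable
  have hfm : Measurable f := (Lp.stronglyMeasurable f).measurable
  have hc0 : Real.sqrt 2 / (2 * Real.pi) ≠ 0 := by positivity
  have hc : |(-(Real.sqrt 2 / (2 * Real.pi)))⁻¹| = 2 * Real.pi / Real.sqrt 2 := by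
    rw [inv_neg, abs_neg, inv_div, abs_of_pos (by positivity)]
  rw [fockMeasure, lintegral_withDensity_eq_lintegral_mul _ (by fun_prop) (by fun_prop),
    ← (Complex.volume_preserving_equiv_real_prod.symm).lintegral_comp_emb
      Complex.measurableEquivRealProd.symm.measurableEmbedding,
    Measure.volume_eq_prod, lintegral_prod _ (Measurable.aemeasurable (by fun_prop))]
  have hinner (s : ℝ) :
      ∫⁻ t : ℝ, ((fun z : ℂ => ENNReal.ofReal (Real.pi⁻¹ * Real.exp (-‖z‖ ^ 2))) *
        fun z => ‖segalBargmann f z‖ₑ ^ 2) (Complex.measurableEquivRealProd.symm (s, t)) =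
      ∫⁻ x : ℝ, ENNReal.ofReal (Real.pi⁻¹ * Real.pi ^ (-(1 / 2) : ℝ) * Real.exp (-2 * s ^ 2) *
        (2 * Real.pi / Real.sqrt 2) * Real.exp (Real.sqrt 2 * s * x - x ^ 2 / 2) ^ 2) *
          ‖f x‖ₑ ^ 2 := by
    have h1 := integrable_gaussianTilt (Lp.memLp f) s
    have hF : Continuous (𝓕 (gaussianTilt f s)) :=
      VectorFourier.fourierIntegral_continuous Real.continuous_fourierChar
        (by exact continuous_inner) h1
    have e (t : ℝ) : Complex.measurableEquivRealProd.symm (s, t) = s + t * Complex.I := by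
      apply Complex.ext <;> simp [Complex.measurableEquivRealProd]
    simp only [Pi.mul_apply, e, weight_mul_enorm_segalBargmann_sq]
    have hscale := lintegral_comp_mul_left_real (neg_ne_zero.2 hc0)
      (fun ξ => ‖(𝓕 (gaussianTilt f s)) ξ‖ₑ ^ 2) (hF.measurable.enorm.pow_const 2)
    rw [lintegral_const_mul' _ _ ENNReal.ofReal_ne_top, hscale, hc,
      lintegral_enorm_fourier_sq h1 (memLp_gaussianTilt (Lp.memLp f) s), ← mul_assoc,
      ← ENNReal.ofReal_mul (by positivity), ← lintegral_const_mul' _ _ ENNReal.ofReal_ne_top]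
    refine lintegral_congr fun x => ?_
    rw [gaussianTilt, enorm_mul, mul_pow, enorm_sq_eq_ofReal (Complex.ofReal _), Complex.norm_real,
      Real.norm_of_nonneg (Real.exp_pos _).le, ← mul_assoc, ← ENNReal.ofReal_mul (by positivity)]
  simp only [hinner]
  rw [lintegral_lintegral_swap (Measurable.aemeasurable (by unfold Function.uncurry; fun_prop))]
  refine lintegral_congr fun x => ?_
  rw [lintegral_mul_const _ (by fun_prop), lintegral_tilt_weight, one_mul]

theorem eLpNorm_segalBargmann (f : Lp ℂ 2 (volume : Measure ℝ)) :
    eLpNorm (segalBargmann f) 2 fockMeasure = eLpNorm f 2 volume := by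
  refine (ENNReal.pow_right_strictMono two_ne_zero).injective ?_
  simp only [eLpNorm_two_sq, lintegral_enorm_segalBargmann_sq]

theorem memLp_segalBargmann (f : Lp ℂ 2 (volume : Measure ℝ)) :
    MemLp (segalBargmann f) 2 fockMeasure :=
  ⟨(differentiable_segalBargmann f).continuous.aestronglyMeasurable, by
    rw [eLpNorm_segalBargmann]
    exact Lp.eLpNorm_lt_top f⟩

/-! ### Unitarity onto Fock space -/

theorem FockSpace.enorm_eq (F : FockSpace) : ‖F‖ₑ = eLpNorm F 2 fockMeasure := by
  have h : ‖F‖ ^ 2 = ‖F.memLp.toLp F‖ ^ 2 := by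
    rw [← Complex.ofReal_inj]
    push_cast
    refine (inner_self_eq_norm_sq_to_K (𝕜 := ℂ) F).symm.trans
      (.trans ?_ (inner_self_eq_norm_sq_to_K (𝕜 := ℂ) (F.memLp.toLp F)))
    rw [FockSpace.inner_def, L2.inner_def]
    refine integral_congr_ae ?_
    filter_upwards [F.memLp.coeFn_toLp] with z hz
    rw [hz, RCLike.inner_apply, mul_comm]
  rw [sq_eq_sq₀ (norm_nonneg _) (norm_nonneg _)] at h
  rw [← Lp.enorm_toLp (hf := F.memLp), ← ofReal_norm, ← ofReal_norm, h]

/-- The Segal–Bargmann transform as a linear isometry into Fock space. -/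
noncomputable def segalBargmannLI : Lp ℂ 2 (volume : Measure ℝ) →ₗᵢ[ℂ] FockSpace where
  toFun f := FockSpace.mk (segalBargmann f) (differentiable_segalBargmann f) (memLp_segalBargmann f)
  map_add' f g := by
    refine DFunLike.ext _ _ fun z => ?_
    simp only [FockSpace.mk_apply, FockSpace.add_apply, segalBargmann]
    rw [← integral_add (integrable_segalBargmannKernel_mul z f)
      (integrable_segalBargmannKernel_mul z g)]
    refine integral_congr_ae ?_
    filter_upwards [Lp.coeFn_add f g] with x hx
    rw [hx, Pi.add_apply, mul_add]
  map_smul' c f := by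
    refine DFunLike.ext _ _ fun z => ?_
    simp only [FockSpace.mk_apply, FockSpace.smul_apply, segalBargmann, RingHom.id_apply]
    rw [← integral_const_mul]
    refine integral_congr_ae ?_
    filter_upwards [Lp.coeFn_smul c f] with x hx
    rw [hx, Pi.smul_apply, smul_eq_mul]
    ring
  norm_map' f := by
    have h := FockSpace.enorm_eq
      (FockSpace.mk (segalBargmann f) (differentiable_segalBargmann f) (memLp_segalBargmann f))
    have h' : ‖FockSpace.mk (segalBargmann f) (differentiable_segalBargmann f)
        (memLp_segalBargmann f)‖ₑ = ‖f‖ₑ :=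
      h.trans ((eLpNorm_segalBargmann f).trans (Lp.enorm_def f).symm)
    simpa using congrArg ENNReal.toReal h'

theorem segalBargmannLI_apply (f : Lp ℂ 2 (volume : Measure ℝ)) (z : ℂ) :
    segalBargmannLI f z = segalBargmann f z := rfl

theorem segalBargmannLI_surjective : Function.Surjective segalBargmannLI := by
  have hcomp : IsComplete (LinearMap.range segalBargmannLI.toLinearMap : Set FockSpace) :=
    segalBargmannLI.isometry.isUniformInducing.isComplete_range
  have : CompleteSpace (LinearMap.range segalBargmannLI.toLinearMap) :=
    completeSpace_coe_iff_isComplete.2 hcomp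
  rw [← LinearIsometry.coe_toLinearMap, ← LinearMap.range_eq_top,
    ← Submodule.orthogonal_eq_bot_iff, Submodule.eq_bot_iff]
  intro F hF
  refine DFunLike.ext _ _ fun w => ?_
  have hk : MemLp (fun x => conj (segalBargmannKernel w x)) 2 := (memLp_segalBargmannKernel w).star
  -- Orthogonality to this element of the range says exactly that F(w) = 0.
  have hv (z : ℂ) : segalBargmannLI (hk.toLp _) z = Complex.exp (z * conj w) := by
    rw [segalBargmannLI_apply, segalBargmann, ← integral_segalBargmannKernel_mul_conj]
    refine integral_congr_ae ?_
    filter_upwards [hk.coeFn_toLp] with x hx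
    rw [hx]
  have h0 : inner ℂ (segalBargmannLI (hk.toLp _)) F = 0 :=
    (Submodule.mem_orthogonal _ _).1 hF _ ⟨_, rfl⟩
  have hi := FockSpace.integrable_conj_mul (segalBargmannLI (hk.toLp _)) F
  rw [FockSpace.inner_def] at h0
  simp only [hv] at h0 hi
  rwa [integral_conj_exp_mul_fockMeasure F.differentiable w hi] at h0

/-! ### The two conjugations -/

theorem segalBargmannKernel_neg (z : ℂ) (x : ℝ) :
    segalBargmannKernel z (-x) = segalBargmannKernel (-z) x := by
  simp [segalBargmannKernel]

theorem segalBargmann_timeReversal (f : Lp ℂ 2 (volume : Measure ℝ)) (z : ℂ) :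
    segalBargmann (timeReversal f) z = conj (segalBargmann f (conj z)) := by
  rw [segalBargmann, segalBargmann, ← integral_conj]
  refine integral_congr_ae ?_
  filter_upwards [timeReversal_ae f] with x hx
  rw [hx, map_mul, conj_segalBargmannKernel, Complex.conj_conj]

theorem segalBargmann_parityTime (f : Lp ℂ 2 (volume : Measure ℝ)) (z : ℂ) :
    segalBargmann (parityTime f) z = conj (segalBargmann f (conj (-z))) := by
  -- The substitution x ↦ -x moves the reflection from f to the kernel, where it becomes z ↦ -z.
  rw [segalBargmann, segalBargmann, ← integral_conj, ← integral_neg_eq_self]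
  refine integral_congr_ae ?_
  filter_upwards [(Measure.measurePreserving_neg volume).quasiMeasurePreserving.ae
    (parityTime_ae f)] with x hx
  rw [hx, neg_neg, map_mul, conj_segalBargmannKernel, Complex.conj_conj, segalBargmannKernel_neg]

theorem proposition5p5 :
    ∃ U : Lp ℂ 2 (volume : Measure ℝ) ≃ₗᵢ[ℂ] FockSpace,
      (∀ f : Lp ℂ 2 (volume : Measure ℝ), ∀ z : ℂ, U f z = segalBargmann f z) ∧
      (∀ g : FockSpace,
        U (timeReversal (U.symm g)) = weightedCompConj 1 0 1 isConjugationParam_one g) ∧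
      (∀ g : FockSpace,
        U (parityTime (U.symm g)) = weightedCompConj (-1) 0 1 isConjugationParam_neg_one g) := by
  let U := LinearIsometryEquiv.ofSurjective segalBargmannLI segalBargmannLI_surjective
  have hU (f : Lp ℂ 2 (volume : Measure ℝ)) (z : ℂ) : U f z = segalBargmann f z := rfl
  refine ⟨U, hU, fun g => ?_, fun g => ?_⟩
  · refine DFunLike.ext _ _ fun z => ?_
    rw [hU, segalBargmann_timeReversal, ← hU, U.apply_symm_apply, weightedCompConj_apply]
    simp
  · refine DFunLike.ext _ _ fun z => ?_
    rw [hU, segalBargmann_parityTime, ← hU, U.apply_symm_apply, weightedCompConj_apply]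
    simp
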